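/- Let $G$ be a locally compact Hausdorff topological group with identity $e$ and let $A$ be a unital C*-algebra. A C*-partial action of $G$ on $A$ is a pair $\alpha=(\{A_t\}_{t\in G},\{\alpha_t\}_{t\in G})$ where each $A_t$ is a closed two-sided ideal of $A$ and each $\alpha_t\colon A_{t^{-1}}\to A_t$ is a *-isomorphism, such that $A_e=A$, $\alpha_e=\mathrm{id}_A$, $\alpha_t(A_{t^{-1}}\cap A_s)=A_t\cap A_{ts}$ and $\alpha_{st}=\alpha_s\circ\alpha_t$ on $A_{t^{-1}s^{-1}}\cap A_{t^{-1}}$ for all $s,t\in G$, and such that the map $\{(t,a)\in G\times A: a\in A_{t^{-1}}\}\to A$, $(t,a)\mapsto\alpha_t(a)$, is continuous. An enveloping action (C*-enveloping pair) of $\alpha$ is a pair $(\mu,\beta)$ where $\beta$ is an action of $G$ by *-automorphisms on a (not necessarily unital) C*-algebra $B$ such that $(t,b)\mapsto\beta_t(b)$ is continuous on $G\times B$, and $\mu\colon A\to B$ is an injective *-homomorphism such that $\mu(A)$ is a two-sided ideal of $B$, $\mu(A_t)=\mu(A)\cap\beta_t(\mu(A))$ for all $t\in G$, $\mu(\alpha_t(a))=\beta_t(\mu(a))$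 for all $t\in G$ and $a\in A_{t^{-1}}$, and $\operatorname{span}\bigcup_{t\in G}\beta_t(\mu(A))$ is dense in $B$. Let $\alpha$ be a C*-partial action of $G$ on $A$. Then $\alpha$ has an enveloping action if and only if each ideal $A_t$ is unital, with unit denoted $1_t$, and the function $G\to A$, $t\mapsto 1_t$, is continuous at $e$. Moreover, if the family $\{A_t\}_{t\in G}$ is continuous, meaning that $\{t\in G: A_t\cap U\neq\emptyset\}$ is open in $G$ for every open $U\subseteq A$, then $\alpha$ has an enveloping action if and only if each $A_t$ is unital. -/

import Mathlib

universe u v w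

/-- A (continuous) C*-partial action of a topological group `G` on a C*-algebra `A`.
Closed two-sided ideals of a C*-algebra are automatically closed under `star` and are in particular
*-subalgebras; `NonUnitalStarSubalgebra` is used so that the `α_t` can be *-isomorphisms.
The continuity of the family of ideals is not part of the definition. -/
structure CStarPartialAction (G : Type u) (A : Type v) [Group G] [TopologicalSpace G]
    [NonUnitalCStarAlgebra A] where
  /-- the ideal `A_t` -/
  ideal : G → NonUnitalStarSubalgebra ℂ A
  isClosed_ideal : ∀ t, IsClosed (ideal t : Set A)
  mul_mem_left : ∀ t (a x : A), x ∈ ideal t → a * x ∈ ideal t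
  mul_mem_right : ∀ t (a x : A), x ∈ ideal t → x * a ∈ ideal t
  /-- the *-isomorphism `α_t : A_{t⁻¹} → A_t` -/
  map : ∀ t, ideal t⁻¹ ≃⋆ₐ[ℂ] ideal t
  ideal_one : ideal 1 = ⊤
  map_one : ∀ a : ideal (1 : G)⁻¹, (map 1 a : A) = a
  /-- `α_t (A_{t⁻¹} ∩ A_s) = A_t ∩ A_{ts}` -/
  image_inter : ∀ t s,
    (fun a : ideal t⁻¹ => (map t a : A)) '' {a | (a : A) ∈ ideal s} =
      (ideal t : Set A) ∩ (ideal (t * s) : Set A)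
  /-- `α_{st} = α_s ∘ α_t` on `A_{(st)⁻¹} ∩ A_{t⁻¹}`; the membership `h` always holds
  there, by `image_inter`. -/
  map_mul : ∀ (s t : G) (a : A) (hst : a ∈ ideal (s * t)⁻¹) (ht : a ∈ ideal t⁻¹)
    (h : (map t ⟨a, ht⟩ : A) ∈ ideal s⁻¹),
    (map (s * t) ⟨a, hst⟩ : A) = map s ⟨map t ⟨a, ht⟩, h⟩
  continuous_map : Continuous
    (fun p : {p : G × A // p.2 ∈ ideal p.1⁻¹} => (map p.1.1 ⟨p.1.2, p.2⟩ : A))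

namespace CStarPartialAction

variable {G : Type u} {A : Type v} [Group G] [TopologicalSpace G] [NonUnitalCStarAlgebra A]

/-- A C*-enveloping pair `(μ, β)` of `α`, with `β` a continuous global action of `G` on the
C*-algebra `B`: `μ` is an isomorphism of `α` onto the restriction of `β` to the ideal `μ(A)` (whose
domains are `μ(A) ∩ β_t(μ(A))`), and the linear span of the `β_t(μ(A))` is dense in `B`. -/
structure EnvelopingPair (α : CStarPartialAction G A) (B : Type w) [NonUnitalCStarAlgebra B] where
  /-- the global action -/
  β : G →* (B ≃⋆ₐ[ℂ] B)
  continuous_β : Continuous (fun p : G × B => β p.1 p.2)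
  /-- the embedding of `A` in `B` -/
  μ : A →⋆ₙₐ[ℂ] B
  injective_μ : Function.Injective μ
  mul_mem_left : ∀ (b : B) (a : A), b * μ a ∈ Set.range μ
  mul_mem_right : ∀ (b : B) (a : A), μ a * b ∈ Set.range μ
  image_ideal : ∀ t, μ '' (α.ideal t : Set A) = Set.range μ ∩ β t '' Set.range μ
  map_comm : ∀ t (a : α.ideal t⁻¹), μ (α.map t a : A) = β t (μ a)
  dense_span : Dense (Submodule.span ℂ (⋃ t, β t '' Set.range μ) : Set B)

/-- `α` has an enveloping action. A C*-algebra that is the closed span of the images of `A` under a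
family indexed by `G` has a copy in `Type (max u v)`, so the universe is no restriction. -/
def HasEnvelopingAction (α : CStarPartialAction G A) : Prop :=
  ∃ (B : Type (max u v)) (_ : NonUnitalCStarAlgebra B), Nonempty (α.EnvelopingPair B)

/-- `e` is a (necessarily unique) unit of the algebra `A_t`. -/
def IsUnitOfIdeal (α : CStarPartialAction G A) (t : G) (e : A) : Prop :=
  e ∈ α.ideal t ∧ ∀ a ∈ α.ideal t, e * a = a ∧ a * e = a

/-- The family of ideals `{A_t}` is continuous: for every open `U ⊆ A` the set of all `t` for which
`A_t` meets `U` is open in `G`. -/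
def IsContinuousFamily (α : CStarPartialAction G A) : Prop :=
  ∀ U : Set A, IsOpen U → IsOpen {t : G | ((α.ideal t : Set A) ∩ U).Nonempty}

end CStarPartialAction

open Filter Topology
open scoped ENNReal

namespace CStarPartialAction

section Units

variable {G : Type u} {A : Type v} [Group G] [TopologicalSpace G] [CStarAlgebra A]
  {α : CStarPartialAction G A}

namespace IsUnitOfIdeal

variable {t : G} {p : A}

theorem commute (hp : α.IsUnitOfIdeal t p) (a : A) : p * a = a * p :=
  calc p * a = p * a * p := ((hp.2 _ (α.mul_mem_right t a p hp.1)).2).symm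
    _ = a * p := by rw [mul_assoc]; exact (hp.2 _ (α.mul_mem_left t a p hp.1)).1

theorem star_eq (hp : α.IsUnitOfIdeal t p) : star p = p := by
  have h : p * star p = star p := (hp.2 _ (star_mem hp.1)).1
  calc star p = p * star p := h.symm
    _ = star (p * star p) := by simp
    _ = p := by rw [h, star_star]

theorem mul_self (hp : α.IsUnitOfIdeal t p) : p * p = p := (hp.2 _ hp.1).1

theorem eq_one_of_norm_sub_one_lt (hp : α.IsUnitOfIdeal t p) {x : A} (hx : x ∈ α.ideal t)
    (h : ‖1 - x‖ < 1) : p = 1 := by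
  have hu : IsUnit x := by
    have := isUnit_one_sub_of_norm_lt_one h
    simpa using this
  exact hu.mul_right_cancel (by rw [(hp.2 x hx).1, one_mul])

end IsUnitOfIdeal

theorem mem_ideal_one (a : A) : a ∈ α.ideal 1 := by
  rw [α.ideal_one]; trivial

theorem IsUnitOfIdeal.eq_one {p : A} (hp : α.IsUnitOfIdeal 1 p) : p = 1 := by
  simpa using (hp.2 1 (mem_ideal_one 1)).1

theorem map_mem_ideal_mul (t s : G) (a : A) (ha : a ∈ α.ideal t⁻¹) (hs : a ∈ α.ideal s) :
    (α.map t ⟨a, ha⟩ : A) ∈ α.ideal (t * s) := by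
  have := (α.image_inter t s).subset ⟨⟨a, ha⟩, hs, rfl⟩
  exact this.2

variable (α) in
/-- A family of units of the ideals of a partial action. -/
structure UnitFamily where
  /-- the unit of the ideal at `t` -/
  unit : G → A
  isUnit : ∀ t, α.IsUnitOfIdeal t (unit t)

namespace UnitFamily

variable (e : α.UnitFamily)

/-- The *-endomorphism `a ↦ α_t (1_{t⁻¹} a)` of `A`. -/
noncomputable def endo (t : G) : A →⋆ₙₐ[ℂ] A where
  toFun a := α.map t ⟨e.unit t⁻¹ * a, α.mul_mem_right _ _ _ (e.isUnit t⁻¹).1⟩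
  map_smul' c a := by
    have : (⟨e.unit t⁻¹ * (c • a), α.mul_mem_right _ _ _ (e.isUnit t⁻¹).1⟩ : α.ideal t⁻¹) =
      c • ⟨e.unit t⁻¹ * a, α.mul_mem_right _ _ _ (e.isUnit t⁻¹).1⟩ :=
      Subtype.ext (mul_smul_comm _ _ _)
    rw [this, map_smul]; rfl
  map_zero' := by
    have : (⟨e.unit t⁻¹ * 0, α.mul_mem_right _ _ _ (e.isUnit t⁻¹).1⟩ : α.ideal t⁻¹) = 0 :=
      Subtype.ext (mul_zero _)
    rw [this, map_zero]; rfl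
  map_add' a b := by
    have : (⟨e.unit t⁻¹ * (a + b), α.mul_mem_right _ _ _ (e.isUnit t⁻¹).1⟩ : α.ideal t⁻¹) =
      ⟨e.unit t⁻¹ * a, α.mul_mem_right _ _ _ (e.isUnit t⁻¹).1⟩ +
        ⟨e.unit t⁻¹ * b, α.mul_mem_right _ _ _ (e.isUnit t⁻¹).1⟩ :=
      Subtype.ext (mul_add _ _ _)
    rw [this, map_add]; rfl
  map_mul' a b := by
    have : (⟨e.unit t⁻¹ * (a * b), α.mul_mem_right _ _ _ (e.isUnit t⁻¹).1⟩ : α.ideal t⁻¹) =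
      ⟨e.unit t⁻¹ * a, α.mul_mem_right _ _ _ (e.isUnit t⁻¹).1⟩ *
        ⟨e.unit t⁻¹ * b, α.mul_mem_right _ _ _ (e.isUnit t⁻¹).1⟩ := by
      refine Subtype.ext ?_
      change e.unit t⁻¹ * (a * b) = e.unit t⁻¹ * a * (e.unit t⁻¹ * b)
      rw [(e.isUnit t⁻¹).commute b, ← mul_assoc, ← mul_assoc,
        (e.isUnit _).2 _ (α.mul_mem_right _ _ _ (α.mul_mem_right _ a _ (e.isUnit t⁻¹).1)) |>.2]
    rw [this, _root_.map_mul]; rfl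
  map_star' a := by
    have : (⟨e.unit t⁻¹ * star a, α.mul_mem_right _ _ _ (e.isUnit t⁻¹).1⟩ : α.ideal t⁻¹) =
      star ⟨e.unit t⁻¹ * a, α.mul_mem_right _ _ _ (e.isUnit t⁻¹).1⟩ := by
      refine Subtype.ext ?_
      change e.unit t⁻¹ * star a = star (e.unit t⁻¹ * a)
      rw [star_mul, (e.isUnit _).star_eq, (e.isUnit _).commute]
    rw [this, map_star]; rfl

theorem endo_apply_of_mem (t : G) (a : A) (ha : a ∈ α.ideal t⁻¹) :
    e.endo t a = α.map t ⟨a, ha⟩ := by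
  change (α.map t ⟨e.unit t⁻¹ * a, _⟩ : A) = _
  congr 3
  exact ((e.isUnit _).2 a ha).1

theorem endo_mem (t : G) (a : A) : e.endo t a ∈ α.ideal t := (α.map t _).2

theorem unit_mul_endo (t : G) (a : A) : e.unit t * e.endo t a = e.endo t a :=
  ((e.isUnit t).2 _ (e.endo_mem t a)).1

theorem endo_unit_inv_mul (t : G) (a : A) : e.endo t (e.unit t⁻¹ * a) = e.endo t a := by
  have h := α.mul_mem_right _ a _ (e.isUnit t⁻¹).1
  rw [e.endo_apply_of_mem t _ h]; rfl

theorem endo_mem_mul (t s : G) (a : A) (ha : a ∈ α.ideal s) : e.endo t a ∈ α.ideal (t * s) :=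
  map_mem_ideal_mul t s _ _ (α.mul_mem_left _ _ _ ha)

theorem unit_one : e.unit 1 = 1 := (e.isUnit 1).eq_one

theorem endo_one (a : A) : e.endo 1 a = a := by
  rw [e.endo_apply_of_mem 1 a (by rw [inv_one]; exact mem_ideal_one a), α.map_one]

theorem endo_unit (t s : G) : e.endo t (e.unit s) = e.unit t * e.unit (t * s) := by
  have hmem : e.unit t * e.unit (t * s) ∈ (α.ideal t : Set A) ∩ α.ideal (t * s) :=
    ⟨α.mul_mem_right _ _ _ (e.isUnit t).1, α.mul_mem_left _ _ _ (e.isUnit (t * s)).1⟩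
  rw [← α.image_inter] at hmem
  obtain ⟨⟨y, hy⟩, hys, hyx⟩ := hmem
  replace hyx : e.endo t y = e.unit t * e.unit (t * s) := by
    rw [e.endo_apply_of_mem t y hy]; exact hyx
  calc e.endo t (e.unit s) = e.endo t (e.unit s) * e.unit (t * s) :=
        ((e.isUnit _).2 _ (e.endo_mem_mul t s _ (e.isUnit s).1)).2.symm
    _ = e.endo t (e.unit s) * (e.unit t * e.unit (t * s)) := by
        rw [← mul_assoc, ((e.isUnit t).2 _ (e.endo_mem t _)).2]
    _ = e.endo t (e.unit s * y) := by rw [← hyx, _root_.map_mul]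
    _ = e.unit t * e.unit (t * s) := by rw [((e.isUnit s).2 y hys).1, hyx]

theorem endo_one_right (t : G) : e.endo t 1 = e.unit t := by
  have h := e.endo_unit t 1
  rwa [e.unit_one, mul_one, (e.isUnit t).mul_self] at h

theorem endo_endo (s t : G) (a : A) : e.endo s (e.endo t a) = e.unit s * e.endo (s * t) a := by
  set x := e.unit (s * t)⁻¹ * (e.unit t⁻¹ * a) with hx
  have h₁ : x ∈ α.ideal (s * t)⁻¹ := α.mul_mem_right _ _ _ (e.isUnit _).1
  have h₂ : x ∈ α.ideal t⁻¹ := α.mul_mem_left _ _ _ (α.mul_mem_right _ _ _ (e.isUnit _).1)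
  have h₃ : e.endo t x = e.unit s⁻¹ * e.endo t a := by
    rw [hx, _root_.map_mul, e.endo_unit_inv_mul, e.endo_unit, mul_inv_rev, mul_inv_cancel_left,
      (e.isUnit t).commute, mul_assoc, e.unit_mul_endo]
  have h₄ : e.endo (s * t) x = e.endo s (e.endo t x) := by
    have h₅ : e.endo t x ∈ α.ideal s⁻¹ := by
      rw [h₃]; exact α.mul_mem_right _ _ _ (e.isUnit _).1
    rw [e.endo_apply_of_mem s _ h₅, e.endo_apply_of_mem _ _ h₁]
    have h₆ := e.endo_apply_of_mem _ _ h₂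
    rw [h₆] at h₅
    rw [α.map_mul s t x h₁ h₂ h₅]
    congr 3
    exact h₆.symm
  calc e.endo s (e.endo t a) = e.endo (s * t) x := by rw [h₄, h₃, e.endo_unit_inv_mul]
    _ = e.unit s * e.endo (s * t) a := by
      rw [hx, e.endo_unit_inv_mul, _root_.map_mul, e.endo_unit, mul_inv_cancel_right,
        (e.isUnit (s * t)).commute, mul_assoc, e.unit_mul_endo]

theorem norm_endo_le (t : G) (a : A) : ‖e.endo t a‖ ≤ ‖a‖ :=
  NonUnitalStarAlgHom.norm_apply_le _ a

theorem unit_mul_eq {h : G} (h₁ : e.unit h = 1) (h₂ : e.unit h⁻¹ = 1) (s : G) :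
    e.unit (s * h) = e.unit s := by
  have key : ∀ (s k : G), e.unit k = 1 → e.unit s * e.unit (s * k) = e.unit s := fun s k hk => by
    rw [← e.endo_unit, hk, e.endo_one_right]
  rw [← key s h h₁, (e.isUnit s).commute]
  simpa using (key (s * h) h⁻¹ h₂).symm

theorem norm_endo_mul_sub_le {h : G} (h₁ : e.unit h = 1) (h₂ : e.unit h⁻¹ = 1) (s : G) (a : A) :
    ‖e.endo (s * h) a - e.endo s a‖ ≤ ‖e.endo h a - a‖ := by
  have : e.endo (s * h) a = e.endo s (e.endo h a) := by
    rw [e.endo_endo, ← e.unit_mul_eq h₁ h₂ s, e.unit_mul_endo]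
  rw [this, ← map_sub]
  exact e.norm_endo_le _ _

theorem eventually_unit_eq_one (he : ContinuousAt e.unit 1) : ∀ᶠ h in 𝓝 1, e.unit h = 1 := by
  have : ∀ᶠ h in 𝓝 (1 : G), e.unit h ∈ Metric.ball (1 : A) 1 := by
    refine he.eventually_mem (Metric.isOpen_ball.mem_nhds ?_)
    rw [e.unit_one]; simp
  filter_upwards [this] with h hh
  refine (e.isUnit h).eq_one_of_norm_sub_one_lt (e.isUnit h).1 ?_
  rwa [Metric.mem_ball, dist_comm, dist_eq_norm] at hh

theorem tendsto_endo [IsTopologicalGroup G] (he : ∀ᶠ h in 𝓝 1, e.unit h = 1) (a : A) :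
    Tendsto (fun h => e.endo h a) (𝓝 1) (𝓝 a) := by
  have hS : {h : G | e.unit h⁻¹ = 1} ∈ 𝓝 (1 : G) := by
    have : Tendsto (fun h : G => h⁻¹) (𝓝 1) (𝓝 1) := by
      simpa using (continuous_inv (G := G)).tendsto 1
    exact this.eventually he
  have hmem : ∀ h : {h : G | e.unit h⁻¹ = 1}, a ∈ α.ideal (h : G)⁻¹ := fun h => by
    have := α.mul_mem_right _ a _ (e.isUnit (h : G)⁻¹).1
    rwa [h.2, one_mul] at this
  have hc : ContinuousOn (fun h => e.endo h a) {h : G | e.unit h⁻¹ = 1} := by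
    rw [continuousOn_iff_continuous_domRestrict]
    have : Continuous fun h : {h : G | e.unit h⁻¹ = 1} =>
        (⟨(h, a), hmem h⟩ : {p : G × A // p.2 ∈ α.ideal p.1⁻¹}) := by fun_prop
    refine (α.continuous_map.comp this).congr fun h => ?_
    exact (e.endo_apply_of_mem _ _ (hmem h)).symm
  have := (hc.continuousAt hS).tendsto
  rwa [e.endo_one] at this

end UnitFamily

theorem EnvelopingPair.exists_unitFamily {B : Type w} [NonUnitalCStarAlgebra B]
    (E : α.EnvelopingPair B) : ∃ e : α.UnitFamily, Continuous e.unit := by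
  have hμ : Isometry E.μ := NonUnitalStarAlgHom.isometry _ E.injective_μ
  set p := E.μ 1
  have hpl : ∀ a, p * E.μ a = E.μ a := fun a => by rw [← _root_.map_mul, one_mul]
  have hpr : ∀ a, E.μ a * p = E.μ a := fun a => by rw [← _root_.map_mul, mul_one]
  have hcomm : ∀ b, p * b = b * p := fun b => by
    obtain ⟨x, hx⟩ := E.mul_mem_right b 1
    obtain ⟨y, hy⟩ := E.mul_mem_left b 1
    calc p * b = p * b * p := by rw [← hx, hpr]
      _ = b * p := by rw [mul_assoc, ← hy, hpl]
  have hex : ∀ t, ∃ x : A, x ∈ α.ideal t ∧ E.μ x = p * E.β t p := fun t => by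
    have h₁ : p * E.β t p ∈ Set.range E.μ ∩ E.β t '' Set.range E.μ := by
      refine ⟨E.mul_mem_right _ 1, ?_⟩
      obtain ⟨y, hy⟩ := E.mul_mem_left ((E.β t).symm p) 1
      refine ⟨_, ⟨y, rfl⟩, ?_⟩
      rw [hy, _root_.map_mul]
      simp [p]
    rw [← E.image_ideal] at h₁
    exact h₁
  choose f hf hfμ using hex
  refine ⟨⟨f, fun t => ⟨hf t, fun a ha => ?_⟩⟩, ?_⟩
  · obtain ⟨-, _, ⟨c, rfl⟩, hc⟩ : E.μ a ∈ Set.range E.μ ∩ E.β t '' Set.range E.μ := by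
      rw [← E.image_ideal]; exact ⟨a, ha, rfl⟩
    constructor <;> apply E.injective_μ
    · rw [_root_.map_mul, hfμ, mul_assoc, ← hc, ← _root_.map_mul, hpl, hc, hpl]
    · rw [_root_.map_mul, hfμ, hcomm, ← mul_assoc, ← hc, ← _root_.map_mul, hpr, hc, hpr]
  · rw [hμ.isUniformInducing.isInducing.continuous_iff]
    have : Continuous fun t : G => E.β t p :=
      E.continuous_β.comp (Continuous.prodMk_left p)
    exact (continuous_const.mul this).congr fun t => (hfμ t).symm

theorem IsContinuousFamily.eventually_unit_eq_one (hα : α.IsContinuousFamily)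
    (e : α.UnitFamily) : ∀ᶠ h in 𝓝 1, e.unit h = 1 := by
  have h₁ : (1 : G) ∈ {t : G | ((α.ideal t : Set A) ∩ Metric.ball 1 1).Nonempty} :=
    ⟨1, mem_ideal_one 1, by simp⟩
  filter_upwards [(hα _ Metric.isOpen_ball).mem_nhds h₁] with h hh
  obtain ⟨x, hx, hx'⟩ := hh
  refine (e.isUnit h).eq_one_of_norm_sub_one_lt hx ?_
  rwa [Metric.mem_ball, dist_comm, dist_eq_norm] at hx'

end Units

end CStarPartialAction

section Translation

variable {G : Type u} {A : Type v} [Group G] [NonUnitalCStarAlgebra A]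

theorem Memℓp.comp_mul_left {f : G → A} (hf : Memℓp f ∞) (t : G) :
    Memℓp (fun s => f (t * s)) ∞ :=
  memℓp_infty <| (memℓp_infty_iff.1 hf).mono <| by
    rintro _ ⟨s, rfl⟩
    exact ⟨t * s, rfl⟩

/-- Left translation by `t` on `ℓ^∞(G, A)`, as a *-endomorphism. -/
noncomputable def lpTranslateHom (t : G) :
    lp (fun _ : G => A) ∞ →⋆ₙₐ[ℂ] lp (fun _ : G => A) ∞ where
  toFun f := ⟨fun s => f (t⁻¹ * s), (lp.memℓp f).comp_mul_left t⁻¹⟩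
  map_smul' _ _ := rfl
  map_zero' := rfl
  map_add' _ _ := rfl
  map_mul' _ _ := rfl
  map_star' _ := rfl

@[simp]
theorem lpTranslateHom_apply (t : G) (f : lp (fun _ : G => A) ∞) (s : G) :
    lpTranslateHom t f s = f (t⁻¹ * s) := rfl

theorem lpTranslateHom_one (f : lp (fun _ : G => A) ∞) : lpTranslateHom 1 f = f := by
  ext s; simp

theorem lpTranslateHom_mul (s t : G) (f : lp (fun _ : G => A) ∞) :
    lpTranslateHom (s * t) f = lpTranslateHom s (lpTranslateHom t f) := by
  ext r; simp [mul_assoc]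

theorem isometry_lpTranslateHom (t : G) :
    Isometry (lpTranslateHom t : lp (fun _ : G => A) ∞ → lp (fun _ : G => A) ∞) := by
  refine NonUnitalStarAlgHom.isometry _ (Function.LeftInverse.injective (g := lpTranslateHom t⁻¹) ?_)
  intro f
  rw [← lpTranslateHom_mul, inv_mul_cancel, lpTranslateHom_one]

end Translation

namespace CStarPartialAction.UnitFamily

variable {G : Type u} {A : Type v} [Group G] [TopologicalSpace G] [CStarAlgebra A]
  {α : CStarPartialAction G A} (e : α.UnitFamily)

/-- The embedding `a ↦ (s ↦ α_{s⁻¹} (1_s a))` of `A` in `ℓ^∞(G, A)`. -/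
noncomputable def embed : A →⋆ₙₐ[ℂ] lp (fun _ : G => A) ∞ where
  toFun a := ⟨fun s => e.endo s⁻¹ a, memℓp_infty ⟨‖a‖, by
    rintro _ ⟨s, rfl⟩
    exact e.norm_endo_le _ _⟩⟩
  map_smul' c a := lp.ext <| funext fun s => map_smul (e.endo s⁻¹) c a
  map_zero' := lp.ext <| funext fun s => map_zero (e.endo s⁻¹)
  map_add' a b := lp.ext <| funext fun s => map_add (e.endo s⁻¹) a b
  map_mul' a b := lp.ext <| funext fun s => _root_.map_mul (e.endo s⁻¹) a b
  map_star' a := lp.ext <| funext fun s => map_star (e.endo s⁻¹) a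

@[simp]
theorem embed_apply (a : A) (s : G) : e.embed a s = e.endo s⁻¹ a := rfl

theorem embed_injective : Function.Injective e.embed := fun a b h => by
  have : e.embed a 1 = e.embed b 1 := by rw [h]
  simpa [e.endo_one] using this

theorem translate_embed_apply (t : G) (a : A) (s : G) :
    lpTranslateHom t (e.embed a) s = e.endo (s⁻¹ * t) a := by simp

theorem translate_embed_mul_embed (t : G) (a b : A) :
    lpTranslateHom t (e.embed a) * e.embed b = e.embed (e.endo t a * b) := by
  refine lp.ext <| funext fun s => ?_
  rw [lp.infty_coeFn_mul, Pi.mul_apply, translate_embed_apply, embed_apply, embed_apply,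
    _root_.map_mul, e.endo_endo, (e.isUnit _).commute, mul_assoc, e.unit_mul_endo]

theorem embed_map (t : G) (a : A) (ha : a ∈ α.ideal t⁻¹) :
    e.embed (e.endo t a) = lpTranslateHom t (e.embed a) := by
  refine lp.ext <| funext fun s => ?_
  rw [translate_embed_apply, embed_apply, e.endo_endo]
  refine ((e.isUnit s⁻¹).2 _ ?_).1
  simpa using e.endo_mem_mul (s⁻¹ * t) t⁻¹ a ha

/-- The linear span of the translates of the image of `A` in `ℓ^∞(G, A)`. -/
noncomputable def translatesSpan : Submodule ℂ (lp (fun _ : G => A) ∞) :=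
  Submodule.span ℂ (⋃ t, lpTranslateHom t '' Set.range e.embed)

theorem translate_embed_mem_translatesSpan (t : G) (a : A) :
    lpTranslateHom t (e.embed a) ∈ e.translatesSpan :=
  Submodule.subset_span (Set.mem_iUnion.2 ⟨t, _, ⟨a, rfl⟩, rfl⟩)

theorem translatesSpan_induction {P : (f : lp (fun _ : G => A) ∞) → f ∈ e.translatesSpan → Prop}
    (basic : ∀ t a, P (lpTranslateHom t (e.embed a)) (e.translate_embed_mem_translatesSpan t a))
    (zero : P 0 (zero_mem _))
    (add : ∀ f g hf hg, P f hf → P g hg → P (f + g) (add_mem hf hg))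
    (smul : ∀ (c : ℂ) f hf, P f hf → P (c • f) (Submodule.smul_mem _ c hf))
    {f : lp (fun _ : G => A) ∞} (hf : f ∈ e.translatesSpan) : P f hf := by
  refine Submodule.span_induction (p := P) ?_ zero add smul hf
  rintro _ hx
  obtain ⟨t, _, ⟨a, rfl⟩, rfl⟩ := Set.mem_iUnion.1 hx
  exact basic t a

theorem translate_mem_translatesSpan (t : G) {f : lp (fun _ : G => A) ∞}
    (hf : f ∈ e.translatesSpan) : lpTranslateHom t f ∈ e.translatesSpan := by
  induction hf using e.translatesSpan_induction with
  | basic s a => rw [← lpTranslateHom_mul]; exact e.translate_embed_mem_translatesSpan _ _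
  | zero => rw [map_zero]; exact zero_mem _
  | add f g _ _ hf hg => rw [map_add]; exact add_mem hf hg
  | smul c f _ hf => rw [map_smul]; exact Submodule.smul_mem _ c hf

theorem mul_embed_mem_range {f : lp (fun _ : G => A) ∞} (hf : f ∈ e.translatesSpan) (b : A) :
    f * e.embed b ∈ Set.range e.embed := by
  induction hf using e.translatesSpan_induction with
  | basic s a => exact ⟨_, (e.translate_embed_mul_embed s a b).symm⟩
  | zero => exact ⟨0, by rw [map_zero, zero_mul]⟩
  | add f g _ _ hf hg =>
    obtain ⟨x, hx⟩ := hf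
    obtain ⟨y, hy⟩ := hg
    exact ⟨x + y, by rw [map_add, hx, hy, add_mul]⟩
  | smul c f _ hf =>
    obtain ⟨x, hx⟩ := hf
    exact ⟨c • x, by rw [map_smul, hx, smul_mul_assoc]⟩

theorem mul_mem_translatesSpan {f g : lp (fun _ : G => A) ∞} (hf : f ∈ e.translatesSpan)
    (hg : g ∈ e.translatesSpan) : f * g ∈ e.translatesSpan := by
  induction hg using e.translatesSpan_induction with
  | basic t b =>
    obtain ⟨x, hx⟩ := e.mul_embed_mem_range (e.translate_mem_translatesSpan t⁻¹ hf) b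
    have : f * lpTranslateHom t (e.embed b) = lpTranslateHom t (e.embed x) := by
      rw [hx, _root_.map_mul, ← lpTranslateHom_mul, mul_inv_cancel, lpTranslateHom_one]
    rw [this]
    exact e.translate_embed_mem_translatesSpan t x
  | zero => rw [mul_zero]; exact zero_mem _
  | add g h _ _ hg hh => rw [mul_add]; exact add_mem hg hh
  | smul c g _ hg => rw [mul_smul_comm]; exact Submodule.smul_mem _ c hg

theorem star_mem_translatesSpan {f : lp (fun _ : G => A) ∞} (hf : f ∈ e.translatesSpan) :
    star f ∈ e.translatesSpan := by
  induction hf using e.translatesSpan_induction with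
  | basic t a =>
    rw [← map_star, ← map_star]
    exact e.translate_embed_mem_translatesSpan t _
  | zero => rw [star_zero]; exact zero_mem _
  | add f g _ _ hf hg => rw [star_add]; exact add_mem hf hg
  | smul c f _ hf => rw [star_smul]; exact Submodule.smul_mem _ _ hf

/-- The closed span of the translates of the image of `A` in `ℓ^∞(G, A)`, which carries the
enveloping action. -/
noncomputable def envelope : NonUnitalStarSubalgebra ℂ (lp (fun _ : G => A) ∞) :=
  NonUnitalStarSubalgebra.topologicalClosure
    { e.translatesSpan with
      mul_mem' := e.mul_mem_translatesSpan
      star_mem' := e.star_mem_translatesSpan }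

theorem isClosed_envelope : IsClosed (e.envelope : Set (lp (fun _ : G => A) ∞)) :=
  isClosed_closure

noncomputable instance : NonUnitalCStarAlgebra e.envelope :=
  NonUnitalStarSubalgebra.nonUnitalCStarAlgebra _ (h_closed := e.isClosed_envelope)

theorem translate_embed_mem_envelope (t : G) (a : A) :
    lpTranslateHom t (e.embed a) ∈ e.envelope :=
  subset_closure (e.translate_embed_mem_translatesSpan t a)

theorem embed_mem_envelope (a : A) : e.embed a ∈ e.envelope := by
  simpa only [lpTranslateHom_one] using e.translate_embed_mem_envelope 1 a

theorem translate_mem_envelope (t : G) {f : lp (fun _ : G => A) ∞} (hf : f ∈ e.envelope) :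
    lpTranslateHom t f ∈ e.envelope :=
  map_mem_closure (isometry_lpTranslateHom t).continuous hf
    fun _ h => e.translate_mem_translatesSpan t h

theorem isClosed_range_embed : IsClosed (Set.range e.embed) :=
  (NonUnitalStarAlgHom.isometry _ e.embed_injective).isClosedEmbedding.isClosed_range

theorem envelope_mul_embed_mem_range {f : lp (fun _ : G => A) ∞} (hf : f ∈ e.envelope) (b : A) :
    f * e.embed b ∈ Set.range e.embed := by
  have := map_mem_closure (f := fun f => f * e.embed b) (t := Set.range e.embed)
    (by fun_prop) hf fun f h => e.mul_embed_mem_range h b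
  rwa [e.isClosed_range_embed.closure_eq] at this

theorem embed_mul_envelope_mem_range {f : lp (fun _ : G => A) ∞} (hf : f ∈ e.envelope) (b : A) :
    e.embed b * f ∈ Set.range e.embed := by
  obtain ⟨x, hx⟩ := e.envelope_mul_embed_mem_range (star_mem hf) (star b)
  refine ⟨star x, ?_⟩
  rw [map_star, hx, star_mul, star_star, ← map_star, star_star]

/-- The embedding of `A` in the envelope. -/
noncomputable def toEnvelope : A →⋆ₙₐ[ℂ] e.envelope :=
  NonUnitalStarAlgHom.codRestrict e.embed e.envelope e.embed_mem_envelope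

theorem coe_toEnvelope (a : A) : (e.toEnvelope a : lp (fun _ : G => A) ∞) = e.embed a := rfl

theorem toEnvelope_injective : Function.Injective e.toEnvelope := fun _ _ h =>
  e.embed_injective (congrArg Subtype.val h)

/-- The global action by translations on the envelope. -/
noncomputable def envelopeAction : G →* (e.envelope ≃⋆ₐ[ℂ] e.envelope) where
  toFun t :=
    { toFun f := ⟨lpTranslateHom t f, e.translate_mem_envelope t f.2⟩
      invFun f := ⟨lpTranslateHom t⁻¹ f, e.translate_mem_envelope t⁻¹ f.2⟩
      left_inv f := Subtype.ext <| by
        simp only [← lpTranslateHom_mul, inv_mul_cancel, lpTranslateHom_one]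
      right_inv f := Subtype.ext <| by
        simp only [← lpTranslateHom_mul, mul_inv_cancel, lpTranslateHom_one]
      map_mul' _ _ := rfl
      map_add' _ _ := rfl
      map_star' _ := rfl
      map_smul' _ _ := rfl }
  map_one' := by
    ext1 f
    exact Subtype.ext (lpTranslateHom_one _)
  map_mul' s t := by
    ext1 f
    exact Subtype.ext (lpTranslateHom_mul s t _)

theorem coe_envelopeAction (t : G) (f : e.envelope) :
    (e.envelopeAction t f : lp (fun _ : G => A) ∞) = lpTranslateHom t f := rfl

theorem isometry_envelopeAction (t : G) : Isometry (e.envelopeAction t) := fun f g =>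
  isometry_lpTranslateHom t (f : lp (fun _ : G => A) ∞) g

theorem norm_translate_embed_sub_le {h : G} (h₁ : e.unit h = 1) (h₂ : e.unit h⁻¹ = 1) (a : A) :
    ‖lpTranslateHom h (e.embed a) - e.embed a‖ ≤ ‖e.endo h a - a‖ := by
  refine lp.norm_le_of_forall_le (norm_nonneg _) fun s => ?_
  rw [lp.coeFn_sub, Pi.sub_apply, translate_embed_apply, embed_apply]
  exact e.norm_endo_mul_sub_le h₁ h₂ s⁻¹ a

theorem dense_span_envelope :
    Dense (Submodule.span ℂ (⋃ t, e.envelopeAction t '' Set.range e.toEnvelope) :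
      Set e.envelope) := by
  rw [Subtype.dense_iff]
  intro f hf
  refine closure_mono (fun g hg => ?_) hf
  induction hg using e.translatesSpan_induction with
  | basic t a =>
    exact ⟨_, Submodule.subset_span (Set.mem_iUnion.2 ⟨t, _, ⟨a, rfl⟩, rfl⟩), rfl⟩
  | zero => exact ⟨0, zero_mem _, rfl⟩
  | add f g _ _ hf hg =>
    obtain ⟨x, hx, rfl⟩ := hf
    obtain ⟨y, hy, rfl⟩ := hg
    exact ⟨x + y, add_mem hx hy, rfl⟩
  | smul c f _ hf =>
    obtain ⟨x, hx, rfl⟩ := hf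
    exact ⟨c • x, Submodule.smul_mem _ c hx, rfl⟩

variable [IsTopologicalGroup G]

theorem tendsto_translate_embed (he : ∀ᶠ h in 𝓝 1, e.unit h = 1) (a : A) :
    Tendsto (fun h => lpTranslateHom h (e.embed a)) (𝓝 1) (𝓝 (e.embed a)) := by
  rw [tendsto_iff_norm_sub_tendsto_zero]
  have hinv : Tendsto (fun h : G => h⁻¹) (𝓝 1) (𝓝 1) := by
    simpa using (continuous_inv (G := G)).tendsto 1
  refine squeeze_zero' (Eventually.of_forall fun _ => norm_nonneg _) ?_
    (tendsto_iff_norm_sub_tendsto_zero.1 (e.tendsto_endo he a))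
  filter_upwards [he, hinv.eventually he] with h h₁ h₂
  exact e.norm_translate_embed_sub_le h₁ h₂ a

theorem continuous_translate_embed (he : ∀ᶠ h in 𝓝 1, e.unit h = 1) (a : A) :
    Continuous fun t => lpTranslateHom t (e.embed a) := by
  refine continuous_iff_continuousAt.2 fun t => ?_
  have h₁ : Tendsto (fun s : G => t⁻¹ * s) (𝓝 t) (𝓝 1) := by
    simpa using (continuous_const_mul t⁻¹).tendsto t
  have h₂ := ((isometry_lpTranslateHom t).continuous.tendsto _).comp
    ((e.tendsto_translate_embed he a).comp h₁)
  refine h₂.congr fun s => ?_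
  simp only [Function.comp_apply, ← lpTranslateHom_mul, mul_inv_cancel_left]

theorem continuous_translate_of_mem_translatesSpan (he : ∀ᶠ h in 𝓝 1, e.unit h = 1)
    {f : lp (fun _ : G => A) ∞} (hf : f ∈ e.translatesSpan) :
    Continuous fun t => lpTranslateHom t f := by
  induction hf using e.translatesSpan_induction with
  | basic s a =>
    simp only [← lpTranslateHom_mul]
    exact (e.continuous_translate_embed he a).comp (continuous_mul_const s)
  | zero => simpa only [map_zero] using continuous_const
  | add f g _ _ hf hg => simp only [map_add]; exact hf.add hg
  | smul c f _ hf => simp only [map_smul]; exact hf.const_smul c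

theorem continuous_translate_of_mem_envelope (he : ∀ᶠ h in 𝓝 1, e.unit h = 1)
    {f : lp (fun _ : G => A) ∞} (hf : f ∈ e.envelope) :
    Continuous fun t => lpTranslateHom t f := by
  refine continuous_of_uniform_approx_of_continuous fun u hu => ?_
  obtain ⟨ε, hε, hεu⟩ := Metric.mem_uniformity_dist.1 hu
  obtain ⟨g, hg, hfg⟩ := Metric.mem_closure_iff.1 hf ε hε
  refine ⟨_, e.continuous_translate_of_mem_translatesSpan he hg, fun t => hεu ?_⟩
  rwa [(isometry_lpTranslateHom t).dist_eq]

theorem continuous_envelopeAction (he : ∀ᶠ h in 𝓝 1, e.unit h = 1) :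
    Continuous fun p : G × e.envelope => e.envelopeAction p.1 p.2 := by
  refine continuous_prod_of_continuous_lipschitzWith' _ 1
    (fun t => (e.isometry_envelopeAction t).lipschitz) (fun f => ?_)
  exact (e.continuous_translate_of_mem_envelope he f.2).subtype_mk _

/-- The enveloping pair built from translations on `ℓ^∞(G, A)`, for a partial action whose ideals
are all unital and equal to `A` near the identity. -/
noncomputable def envelopingPair (he : ∀ᶠ h in 𝓝 1, e.unit h = 1) :
    α.EnvelopingPair e.envelope where
  β := e.envelopeAction
  continuous_β := e.continuous_envelopeAction he
  μ := e.toEnvelope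
  injective_μ := e.toEnvelope_injective
  mul_mem_left b a := by
    obtain ⟨x, hx⟩ := e.envelope_mul_embed_mem_range b.2 a
    exact ⟨x, Subtype.ext hx⟩
  mul_mem_right b a := by
    obtain ⟨x, hx⟩ := e.embed_mul_envelope_mem_range b.2 a
    exact ⟨x, Subtype.ext hx⟩
  image_ideal t := by
    ext b
    constructor
    · rintro ⟨a, ha, rfl⟩
      obtain ⟨c, hc⟩ := (α.map t).surjective ⟨a, ha⟩
      refine ⟨⟨a, rfl⟩, _, ⟨c, rfl⟩, Subtype.ext ?_⟩
      rw [coe_envelopeAction, coe_toEnvelope, ← e.embed_map t c c.2,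
        e.endo_apply_of_mem t c c.2, coe_toEnvelope]
      exact congrArg (fun x : α.ideal t => e.embed x) hc
    · rintro ⟨⟨a, rfl⟩, _, ⟨c, rfl⟩, hc⟩
      refine ⟨a, ?_, rfl⟩
      have h : lpTranslateHom t (e.embed c) 1 = e.embed a 1 :=
        congrFun (congrArg (fun f : e.envelope => ((f : lp (fun _ : G => A) ∞) : G → A)) hc) 1
      rw [translate_embed_apply, embed_apply, inv_one, one_mul, e.endo_one] at h
      rw [← h]
      exact e.endo_mem t c
  map_comm t a := by
    refine Subtype.ext ?_
    rw [coe_envelopeAction, coe_toEnvelope, coe_toEnvelope, ← e.embed_map t a a.2,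
      e.endo_apply_of_mem t a a.2]
  dense_span := e.dense_span_envelope

theorem hasEnvelopingAction (he : ∀ᶠ h in 𝓝 1, e.unit h = 1) : α.HasEnvelopingAction :=
  ⟨e.envelope, inferInstance, ⟨e.envelopingPair he⟩⟩

end CStarPartialAction.UnitFamily

theorem mainTheorem3 {G : Type u} {A : Type v} [Group G] [TopologicalSpace G]
    [IsTopologicalGroup G] [LocallyCompactSpace G] [T2Space G] [CStarAlgebra A]
    (α : CStarPartialAction G A) :
    (α.HasEnvelopingAction ↔
      ∃ e : G → A, (∀ t, α.IsUnitOfIdeal t (e t)) ∧ ContinuousAt e 1) ∧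
    (α.IsContinuousFamily →
      (α.HasEnvelopingAction ↔ ∀ t, ∃ e : A, α.IsUnitOfIdeal t e)) := by
  have hmp : α.HasEnvelopingAction →
      ∃ e : G → A, (∀ t, α.IsUnitOfIdeal t (e t)) ∧ ContinuousAt e 1 := by
    rintro ⟨B, _, ⟨E⟩⟩
    obtain ⟨e, he⟩ := E.exists_unitFamily
    exact ⟨e.unit, e.isUnit, he.continuousAt⟩
  refine ⟨⟨hmp, ?_⟩, fun hα => ⟨fun h t => ?_, fun h => ?_⟩⟩
  · rintro ⟨f, hf, hc⟩
    let e : α.UnitFamily := ⟨f, hf⟩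
    exact e.hasEnvelopingAction (e.eventually_unit_eq_one hc)
  · obtain ⟨f, hf, -⟩ := hmp h
    exact ⟨f t, hf t⟩
  · choose f hf using h
    let e : α.UnitFamily := ⟨f, hf⟩
    exact e.hasEnvelopingAction (hα.eventually_unit_eq_one e)
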